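/- Let $\delta,\rho,B>0$ and $\eta_c>0$, let $c_0,c_1,c_2,c_3\in\mathbb R$, and put $g(A,\eta)=\delta(\eta-\eta_c)$ and $h(A,\eta)=\rho\left(c_0+c_1\eta+c_2\eta^2+c_3\eta^3-\frac{A}{B}\right)$ (with the standard parameter values, $h(A,\eta)=\rho(112.88+56.91\eta-24.31\eta^2-11.05\eta^3-A/1.5)$). On the $(A,\eta)$-plane $\mathbb R^2$ consider the extended system $$\dot A=g(A,\eta),\qquad \dot\eta=\begin{cases}-|h| & \eta>1,\\ \frac{h-|h|}{2} & \eta=1,\\ h & 0<\eta<1,\\ \frac{h+|h|}{2} & \eta=0,\\ |h| & \eta<0,\end{cases}\qquad h=h(A,\eta).$$ An orbit is a Filippov solution $(A(t),\eta(t))$ on a forward time interval $I\ni 0$ (with $I\subseteq[0,\infty)$) that starts at any point of $\mathbb R^2$ at time $0$ and cannot be continued to a larger such interval. Here a Filippov solution of $\dot z=F(z)$ on $I$ is a function $z$ that is absolutely continuous on compact subintervals of $I$ and satisfies $\dot z(t)\in\bigcap_{r>0}\bigcap_{|N|=0}\overline{\mathrm{co}}\,F(B(z(t),r)\setminus N)$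 for almost every $t\in I$. Then every orbit that reaches the snowball boundary $\eta=0$ leaves it in finite time and enters the interior of the physical region $0\le\eta\le1$. Precisely, suppose that $\eta(t_0)=0$ for some $t_0\in I$. Then there are $\tau\in I$ with $\tau\ge t_0$ and $\varepsilon>0$ such that 1. for $t_0\le t\le\tau$ the orbit slides along the boundary with $A$ decreasing at rate $\delta\eta_c$: $\eta(t)=0$ and $A(t)=A(t_0)-\delta\eta_c(t-t_0)$; 2. if $h(A(t_0),0)\le0$, then the sliding ends at the tangency point: $h(A(\tau),0)=0$; if $h(A(t_0),0)>0$, then $\tau=t_0$, so the orbit leaves the boundary at once; 3. $(\tau,\tau+\varepsilon]\subseteq I$ and $0<\eta(t)<1$ for $\tau<t\le\tau+\varepsilon$. Moreover, if $\eta(s)\ge0$ for some $s\in I$ with $s<t_0$ (in particular if the orbit arrives from the physical region), then $h(A(t_0),0)\le0$. -/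

import Mathlib

open MeasureTheory Set

namespace IceLine

/-- Filippov's set-valued map of a vector field `F` on the plane:
`⋂_{r > 0} ⋂_{N null} closure (co (F (B(z, r) \ N)))`. -/
def filippovMap (F : ℝ × ℝ → ℝ × ℝ) (z : ℝ × ℝ) : Set (ℝ × ℝ) :=
  ⋂ (r : ℝ) (_ : 0 < r) (N : Set (ℝ × ℝ)) (_ : volume N = 0),
    closure (convexHull ℝ (F '' (Metric.ball z r \ N)))

/-- `z` is a Filippov solution of `ż = F(z)` on the interval `I`: it is absolutely continuous on
every compact subinterval, and for almost every `t ∈ I` its derivative exists and lies in the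
Filippov set at `z t`. -/
structure IsFilippovSolution (F : ℝ × ℝ → ℝ × ℝ) (I : Set ℝ) (z : ℝ → ℝ × ℝ) : Prop where
  absCont : ∀ a ∈ I, ∀ b ∈ I, a ≤ b → AbsolutelyContinuousOnInterval z a b
  deriv_mem : ∀ᵐ t ∂(volume.restrict I), ∃ v ∈ filippovMap F (z t), HasDerivAt z v t

/-- `I` is an interval with least element `0`: `[0, b)`, `[0, b]` or `[0, ∞)`. -/
def IsForwardInterval (I : Set ℝ) : Prop :=
  (0 : ℝ) ∈ I ∧ I ⊆ Ici 0 ∧ I.OrdConnected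

/-- A forward orbit: a Filippov solution on a forward time interval `I`, starting at time `0` at an
arbitrary point of the plane, that has no continuation to a larger forward interval. -/
structure IsForwardOrbit (F : ℝ × ℝ → ℝ × ℝ) (I : Set ℝ) (z : ℝ → ℝ × ℝ) : Prop where
  interval : IsForwardInterval I
  solution : IsFilippovSolution F I z
  maximal : ∀ (J : Set ℝ) (w : ℝ → ℝ × ℝ), IsForwardInterval J → I ⊆ J →
    IsFilippovSolution F J w → EqOn w z I → J = I

/-- The extension to the whole `(A, η)`-plane of the system `Ȧ = g(A, η)`, `η̇ = h(A, η)` given on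
the strip `0 < η < 1`. -/
noncomputable def extendedField (g h : ℝ → ℝ → ℝ) (z : ℝ × ℝ) : ℝ × ℝ :=
  (g z.1 z.2,
    if 1 < z.2 then -|h z.1 z.2|
    else if z.2 = 1 then (h z.1 z.2 - |h z.1 z.2|) / 2
    else if 0 < z.2 then h z.1 z.2
    else if z.2 = 0 then (h z.1 z.2 + |h z.1 z.2|) / 2
    else |h z.1 z.2|)

/-- The greenhouse gas equation `g(A, η) = δ (η - η_c)`. -/
def greenhouseRate (δ ηc : ℝ) (_A η : ℝ) : ℝ := δ * (η - ηc)

/-- The ice line equation, cubic in `η` and linear in `A`: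
`h(A, η) = ρ (c₀ + c₁ η + c₂ η² + c₃ η³ - A / B)`. The standard parameter values are
`c₀ = 112.88`, `c₁ = 56.91`, `c₂ = -24.31`, `c₃ = -11.05` and `B = 1.5`. -/
noncomputable def iceLineRate (ρ B c₀ c₁ c₂ c₃ : ℝ) (A η : ℝ) : ℝ :=
  ρ * (c₀ + c₁ * η + c₂ * η ^ 2 + c₃ * η ^ 3 - A / B)

/-- The extended ice line / greenhouse gas system. -/
noncomputable def iceField (δ ηc ρ B c₀ c₁ c₂ c₃ : ℝ) : ℝ × ℝ → ℝ × ℝ :=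
  extendedField (greenhouseRate δ ηc) (iceLineRate ρ B c₀ c₁ c₂ c₃)

end IceLine

open Filter Topology

/-! ### Absolutely continuous functions and the sign of their derivative -/

namespace AbsolutelyContinuousOnInterval

/-! Below `η = 0` every Filippov velocity has `η`-component at least `0`, so `η ≥ 0` is forward
invariant (`snd_nonneg`). Hence `A` falls at rate at most `δ ηc` after `t₀`, and `h(A, 0)`, which
decreases in `A`, stays nonpositive up to an explicit time `τ`. Until then `η' ≤ L η` wherever `0 <
η < 1`, and Gronwall pins `η` to `0` (`snd_eq_zero_of_sliding`). So `A` is exactly linear and `h(A,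
0)` vanishes at `τ`.

Past `τ`, `η < ηc` makes `A` strictly decrease, so `h(A, 0) > 0`. There the extended field is
continuous across `η = 0`, and `η' > -L η` forces `η > 0` (`exists_leaving`).

That the orbit lives long enough follows from maximality: `mem_of_extension` glues on the explicit
sliding motion up to `τ`, and a Picard–Lindelöf solution beyond it (`exists_leaving_solution`). -/

lemma lipschitzWith_one_comp {X Y : Type*} [PseudoMetricSpace X] [PseudoMetricSpace Y]
    {f : ℝ → X} {φ : X → Y} {a b : ℝ} (hφ : LipschitzWith 1 φ)
    (hf : AbsolutelyContinuousOnInterval f a b) :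
    AbsolutelyContinuousOnInterval (fun t => φ (f t)) a b := by
  refine squeeze_zero (fun E => Finset.sum_nonneg fun i _ => dist_nonneg) (fun E => ?_) hf
  refine Finset.sum_le_sum fun i _ => ?_
  simpa using hφ.dist_le_mul (f (E.2 i).1) (f (E.2 i).2)

lemma comp_monotone_lipschitzWith_one {X : Type*} [PseudoMetricSpace X]
    {f : ℝ → X} {p : ℝ → ℝ} {a b c d : ℝ} (hf : AbsolutelyContinuousOnInterval f a b)
    (hp : Monotone p) (hpl : LipschitzWith 1 p) (hmap : MapsTo p (uIcc c d) (uIcc a b)) :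
    AbsolutelyContinuousOnInterval (fun t => f (p t)) c d := by
  rw [absolutelyContinuousOnInterval_iff] at hf ⊢
  intro ε hε
  obtain ⟨δ, hδ, H⟩ := hf ε hε
  refine ⟨δ, hδ, fun E hE hlen => ?_⟩
  refine H (E.1, fun i => (p (E.2 i).1, p (E.2 i).2)) ⟨fun i hi => ?_, ?_⟩ ?_
  · exact ⟨hmap (hE.1 i hi).1, hmap (hE.1 i hi).2⟩
  · intro i hi j hj hij
    have hd := hE.2 hi hj hij
    simp only [Function.onFun] at hd ⊢
    rw [Set.disjoint_left] at hd ⊢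
    intro x hx hx'
    simp only [Set.mem_uIoc] at hx hx' hd
    -- A common point of the two image intervals puts each left endpoint below both right endpoints.
    -- `key` lifts this to the sources, where the smaller right endpoint is then a common point.
    have key : ∀ u v : ℝ, p u < p v → u < v := fun u v huv => by
      by_contra hc
      exact absurd (hp (not_lt.1 hc)) (not_le.2 huv)
    rcases hx with hx | hx <;> rcases hx' with hx' | hx'
    all_goals
      have h1 := key _ _ (hx.1.trans_le hx.2)
      have h2 := key _ _ (hx'.1.trans_le hx'.2)
      have h3 := key _ _ (hx.1.trans_le hx'.2)
      have h4 := key _ _ (hx'.1.trans_le hx.2)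
    · refine hd (a := min (E.2 i).2 (E.2 j).2) ?_ ?_ <;> grind
    · refine hd (a := min (E.2 i).2 (E.2 j).1) ?_ ?_ <;> grind
    · refine hd (a := min (E.2 i).1 (E.2 j).2) ?_ ?_ <;> grind
    · refine hd (a := min (E.2 i).1 (E.2 j).1) ?_ ?_ <;> grind
  · refine lt_of_le_of_lt (Finset.sum_le_sum fun i _ => ?_) hlen
    simpa using hpl.dist_le_mul (E.2 i).1 (E.2 i).2

lemma le_of_ae_hasDerivAt_nonneg {f : ℝ → ℝ} {a b : ℝ} (hab : a ≤ b)
    (hf : AbsolutelyContinuousOnInterval f a b)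
    (hd : ∀ᵐ t, t ∈ Ioo a b → ∃ v, HasDerivAt f v t ∧ 0 ≤ v) : f a ≤ f b := by
  rw [← sub_nonneg, ← hf.integral_deriv_eq_sub, intervalIntegral.integral_of_le hab,
    integral_Ioc_eq_integral_Ioo]
  refine setIntegral_nonneg_of_ae_restrict ?_
  rw [EventuallyLE, ae_restrict_iff' measurableSet_Ioo]
  filter_upwards [hd] with t ht hmem
  obtain ⟨v, hv, hv0⟩ := ht hmem
  simpa [hv.deriv] using hv0

/-- Without strict increase the monotone `f` would be constant, so its derivative would vanish on an
interval of positive length. -/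
lemma lt_of_ae_hasDerivAt_pos {f : ℝ → ℝ} {a b : ℝ} (hab : a < b)
    (hf : AbsolutelyContinuousOnInterval f a b)
    (hd : ∀ᵐ t, t ∈ Ioo a b → ∃ v, HasDerivAt f v t ∧ 0 < v) : f a < f b := by
  have hle : ∀ c ∈ Icc a b, ∀ d ∈ Icc a b, c ≤ d → f c ≤ f d := fun c hc d hd' hcd => by
    refine (hf.mono ?_).le_of_ae_hasDerivAt_nonneg hcd ?_
    · rw [uIcc_of_le hcd, uIcc_of_le hab.le]
      exact Icc_subset_Icc hc.1 hd'.2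
    · filter_upwards [hd] with t ht hmem
      obtain ⟨v, hv, hv0⟩ := ht ⟨hc.1.trans_lt hmem.1, hmem.2.trans_le hd'.2⟩
      exact ⟨v, hv, hv0.le⟩
  by_contra hcon
  have hconst : ∀ t ∈ Icc a b, f t = f a := fun t ht =>
    le_antisymm ((hle t ht b (right_mem_Icc.2 hab.le) ht.2).trans (not_lt.1 hcon))
      (hle a (left_mem_Icc.2 hab.le) t ht ht.1)
  have hnull : ∀ᵐ t : ℝ, t ∉ Ioo a b := by
    filter_upwards [hd] with t ht hmem
    obtain ⟨v, hv, hv0⟩ := ht hmem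
    have h0 : HasDerivAt f 0 t := by
      refine (hasDerivAt_const t (f a)).congr_of_eventuallyEq ?_
      filter_upwards [Ioo_mem_nhds hmem.1 hmem.2] with s hs
      exact hconst s (Ioo_subset_Icc_self hs)
    exact hv0.ne' (hv.unique h0)
  have h2 : volume (Ioo a b) = 0 := by
    simpa only [ae_iff, not_not, ofPred_mem_eq] using hnull
  rw [Real.volume_Ioo, ENNReal.ofReal_eq_zero] at h2
  linarith

end AbsolutelyContinuousOnInterval

lemma ContinuousOn.exists_last_nonneg {f : ℝ → ℝ} {a b : ℝ} (hab : a ≤ b)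
    (hf : ContinuousOn f (Icc a b)) (ha : 0 ≤ f a) (hb : f b < 0) :
    ∃ s ∈ Ico a b, 0 ≤ f s ∧ ∀ t ∈ Ioc s b, f t < 0 := by
  have hcl : IsCompact (Icc a b ∩ f ⁻¹' Ici 0) :=
    isCompact_Icc.of_isClosed_subset (hf.preimage_isClosed_of_isClosed isClosed_Icc isClosed_Ici)
      inter_subset_left
  obtain ⟨s, hs, hmax⟩ := hcl.exists_isGreatest ⟨a, left_mem_Icc.2 hab, ha⟩
  have hsb : s ≠ b := by
    rintro rfl
    exact absurd hs.2 (not_le.2 hb)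
  refine ⟨s, ⟨hs.1.1, lt_of_le_of_ne hs.1.2 hsb⟩, hs.2, fun t ht => ?_⟩
  by_contra hc
  exact absurd (hmax ⟨⟨hs.1.1.trans ht.1.le, ht.2⟩, not_lt.1 hc⟩) (not_le.2 ht.1)

/-! ### Filippov sets of the extended field -/

namespace IceLine

lemma filippovMap_subset {F : ℝ × ℝ → ℝ × ℝ} {z : ℝ × ℝ} {C : Set (ℝ × ℝ)} (hC : IsClosed C)
    (hconv : Convex ℝ C) (h : ∀ᶠ w in 𝓝 z, F w ∈ C) : filippovMap F z ⊆ C := by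
  obtain ⟨r, hr, hball⟩ := Metric.eventually_nhds_iff_ball.1 h
  intro v hv
  simp only [filippovMap, mem_iInter] at hv
  refine closure_minimal (convexHull_min ?_ hconv) hC (hv r hr ∅ measure_empty)
  rintro _ ⟨w, hw, rfl⟩
  exact hball w hw.1

/-- One-sided limits of the field survive the removal of null sets, because a nonempty open set has
positive measure. -/
lemma mem_closure_image_ball_diff_null {F G : ℝ × ℝ → ℝ × ℝ} {z : ℝ × ℝ} {s : Set (ℝ × ℝ)}
    (hs : IsOpen s) (hz : z ∈ closure s) (hFG : EqOn F G s) (hG : ContinuousAt G z)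
    {r : ℝ} (hr : 0 < r) {N : Set (ℝ × ℝ)} (hN : volume N = 0) :
    G z ∈ closure (F '' (Metric.ball z r \ N)) := by
  rw [mem_closure_iff_nhds]
  intro U hU
  obtain ⟨V, hVU, hV, hzV⟩ := mem_nhds_iff.1 (hG hU)
  have hopen : IsOpen (V ∩ Metric.ball z r ∩ s) := (hV.inter Metric.isOpen_ball).inter hs
  have hne : (V ∩ Metric.ball z r ∩ s).Nonempty :=
    mem_closure_iff.1 hz _ (hV.inter Metric.isOpen_ball) ⟨hzV, Metric.mem_ball_self hr⟩
  have hpos := hopen.measure_pos volume hne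
  have : ¬ (V ∩ Metric.ball z r ∩ s ⊆ N) := fun hsub => hpos.ne' (measure_mono_null hsub hN)
  obtain ⟨w, hw, hwN⟩ := not_subset.1 this
  exact ⟨F w, by rw [hFG hw.2]; exact hVU hw.1.1, w, ⟨hw.1.2, hwN⟩, rfl⟩

lemma filippovMap_subset_singleton {F G : ℝ × ℝ → ℝ × ℝ} {z : ℝ × ℝ} (hFG : F =ᶠ[𝓝 z] G)
    (hG : ContinuousAt G z) : filippovMap F z ⊆ {G z} := by
  intro v hv
  rw [mem_singleton_iff, ← dist_le_zero]
  refine le_of_forall_gt_imp_ge_of_dense fun ε hε => ?_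
  refine filippovMap_subset (C := Metric.closedBall (G z) ε) Metric.isClosed_closedBall
    (convex_closedBall _ _) ?_ hv
  filter_upwards [hFG, hG (Metric.closedBall_mem_nhds _ hε)] with w hw hw'
  rw [hw]
  exact hw'

section Field

variable {g h : ℝ → ℝ → ℝ} {z v : ℝ × ℝ}

lemma fst_eq_of_mem_filippovMap (hg : Continuous fun w : ℝ × ℝ => g w.1 w.2)
    (hv : v ∈ filippovMap (extendedField g h) z) : v.1 = g z.1 z.2 := by
  rw [← dist_le_zero]
  refine le_of_forall_gt_imp_ge_of_dense fun ε hε => ?_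
  refine filippovMap_subset (C := Prod.fst ⁻¹' Metric.closedBall (g z.1 z.2) ε)
    (Metric.isClosed_closedBall.preimage continuous_fst)
    ((convex_closedBall _ _).linear_preimage (LinearMap.fst ℝ ℝ ℝ)) ?_ hv
  exact hg.continuousAt (Metric.closedBall_mem_nhds _ hε)

lemma snd_nonneg_of_mem_filippovMap (hz : z.2 < 0)
    (hv : v ∈ filippovMap (extendedField g h) z) : 0 ≤ v.2 := by
  refine filippovMap_subset (C := Prod.snd ⁻¹' Ici 0) (isClosed_Ici.preimage continuous_snd)
    ((convex_Ici _).linear_preimage (LinearMap.snd ℝ ℝ ℝ)) ?_ hv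
  filter_upwards [continuous_snd.continuousAt (Iio_mem_nhds hz)] with w hw
  have hw : w.2 < 0 := hw
  have h1 : ¬ 1 < w.2 := by linarith
  have h2 : w.2 ≠ 1 := by linarith
  have h3 : ¬ 0 < w.2 := by linarith
  simp [extendedField, h1, h2, h3, hw.ne]

lemma extendedField_of_mem_Ioo (h0 : 0 < z.2) (h1 : z.2 < 1) :
    extendedField g h z = (g z.1 z.2, h z.1 z.2) := by
  simp [extendedField, h0, h1.ne, not_lt.2 h1.le]

lemma extendedField_of_neg (h0 : z.2 < 0) :
    extendedField g h z = (g z.1 z.2, |h z.1 z.2|) := by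
  have h1 : ¬ 1 < z.2 := by linarith
  have h2 : z.2 ≠ 1 := by linarith
  simp [extendedField, h1, h2, not_lt.2 h0.le, h0.ne]

lemma extendedField_of_pos_of_lt_one (hz : z.2 < 1) (hh : 0 < h z.1 z.2) :
    extendedField g h z = (g z.1 z.2, h z.1 z.2) := by
  simp [extendedField, hz.ne, not_lt.2 hz.le, abs_of_pos hh]

lemma eq_of_mem_filippovMap_of_mem_Ioo
    (hg : Continuous fun w : ℝ × ℝ => g w.1 w.2) (hh : Continuous fun w : ℝ × ℝ => h w.1 w.2)
    (h0 : 0 < z.2) (h1 : z.2 < 1)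
    (hv : v ∈ filippovMap (extendedField g h) z) : v = (g z.1 z.2, h z.1 z.2) := by
  refine filippovMap_subset_singleton (G := fun w => (g w.1 w.2, h w.1 w.2)) ?_
    (hg.prodMk hh).continuousAt hv
  filter_upwards [continuous_snd.continuousAt (Ioo_mem_nhds h0 h1)] with w hw
  exact extendedField_of_mem_Ioo hw.1 hw.2

/-- For `h > 0` the branches with `η ≤ 0` also give `h`, so the field is continuous across the
snowball boundary. -/
lemma eq_of_mem_filippovMap_of_pos
    (hg : Continuous fun w : ℝ × ℝ => g w.1 w.2) (hh : Continuous fun w : ℝ × ℝ => h w.1 w.2)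
    (h1 : z.2 < 1) (hpos : 0 < h z.1 z.2)
    (hv : v ∈ filippovMap (extendedField g h) z) : v = (g z.1 z.2, h z.1 z.2) := by
  refine filippovMap_subset_singleton (G := fun w => (g w.1 w.2, h w.1 w.2)) ?_
    (hg.prodMk hh).continuousAt hv
  filter_upwards [continuous_snd.continuousAt (Iio_mem_nhds h1),
    hh.continuousAt (Ioi_mem_nhds hpos)] with w hw hw'
  exact extendedField_of_pos_of_lt_one hw hw'

lemma mem_filippovMap_of_mem_Ioo
    (hg : Continuous fun w : ℝ × ℝ => g w.1 w.2) (hh : Continuous fun w : ℝ × ℝ => h w.1 w.2)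
    (h0 : 0 < z.2) (h1 : z.2 < 1) :
    (g z.1 z.2, h z.1 z.2) ∈ filippovMap (extendedField g h) z := by
  simp only [filippovMap, mem_iInter]
  intro r hr N hN
  refine closure_mono (subset_convexHull ℝ _) ?_
  exact mem_closure_image_ball_diff_null (s := Prod.snd ⁻¹' Ioo 0 1)
    (G := fun w => (g w.1 w.2, h w.1 w.2)) (isOpen_Ioo.preimage continuous_snd)
    (subset_closure ⟨h0, h1⟩) (fun w hw => extendedField_of_mem_Ioo hw.1 hw.2)
    (hg.prodMk hh).continuousAt hr hN

lemma mem_filippovMap_of_boundary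
    (hg : Continuous fun w : ℝ × ℝ => g w.1 w.2) (hh : Continuous fun w : ℝ × ℝ => h w.1 w.2)
    (h0 : z.2 = 0) (hle : h z.1 z.2 ≤ 0) :
    (g z.1 z.2, 0) ∈ filippovMap (extendedField g h) z := by
  simp only [filippovMap, mem_iInter]
  intro r hr N hN
  have hcl : ∀ s : Set ℝ, 0 ∈ closure s → z ∈ closure (Prod.snd ⁻¹' s : Set (ℝ × ℝ)) := by
    intro s hs
    rw [← univ_prod, closure_prod_eq, closure_univ]
    exact ⟨mem_univ _, by rwa [h0]⟩
  have hup := mem_closure_image_ball_diff_null (F := extendedField g h) (s := Prod.snd ⁻¹' Ioo 0 1)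
    (G := fun w => (g w.1 w.2, h w.1 w.2)) (isOpen_Ioo.preimage continuous_snd)
    (hcl _ (by rw [closure_Ioo (by norm_num)]; simp))
    (fun w hw => extendedField_of_mem_Ioo hw.1 hw.2) (hg.prodMk hh).continuousAt hr hN
  have hdown := mem_closure_image_ball_diff_null (F := extendedField g h) (s := Prod.snd ⁻¹' Iio 0)
    (G := fun w => (g w.1 w.2, |h w.1 w.2|)) (isOpen_Iio.preimage continuous_snd)
    (hcl _ (by rw [closure_Iio]; simp))
    (fun w hw => extendedField_of_neg hw) (hg.prodMk hh.abs).continuousAt hr hN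
  have hconv := (convex_convexHull ℝ (extendedField g h '' (Metric.ball z r \ N))).closure
  -- The limits from above and below have `η`-components `h` and `|h| = -h`; their midpoint is the
  -- sliding velocity.
  have hmid := hconv (closure_mono (subset_convexHull ℝ _) hup)
    (closure_mono (subset_convexHull ℝ _) hdown) (a := 1 / 2) (b := 1 / 2)
    (by norm_num) (by norm_num) (by norm_num)
  convert hmid using 1
  rw [abs_of_nonpos hle]
  ext
  · simp; ring
  · simp

end Field

end IceLine

lemma absolutelyContinuousOnInterval_exp_mul (c a b : ℝ) :
    AbsolutelyContinuousOnInterval (fun t : ℝ => Real.exp (c * t)) a b := by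
  refine ContDiffOn.absolutelyContinuousOnInterval (ContDiff.contDiffOn ?_)
  fun_prop

lemma absolutelyContinuousOnInterval_const_mul_id (c a b : ℝ) :
    AbsolutelyContinuousOnInterval (fun t : ℝ => c * t) a b := by
  refine ContDiffOn.absolutelyContinuousOnInterval (ContDiff.contDiffOn ?_)
  fun_prop

lemma HasDerivAt.exp_mul_mul {f : ℝ → ℝ} {v t : ℝ} (c : ℝ) (hf : HasDerivAt f v t) :
    HasDerivAt (fun s => Real.exp (c * s) * f s) (Real.exp (c * t) * (c * f t + v)) t := by
  have h1 : HasDerivAt (fun s : ℝ => Real.exp (c * s)) (Real.exp (c * t) * c) t := by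
    simpa using ((hasDerivAt_id t).const_mul c).exp
  exact (h1.mul hf).congr_deriv (by ring)

/-! ### Invariance of `η ≥ 0` along Filippov solutions -/

namespace IceLine

namespace IsFilippovSolution

variable {F : ℝ × ℝ → ℝ × ℝ} {I : Set ℝ} {z : ℝ → ℝ × ℝ} {a b : ℝ}

lemma mono {J : Set ℝ} (hz : IsFilippovSolution F I z) (hJ : J ⊆ I) : IsFilippovSolution F J z :=
  ⟨fun a ha b hb => hz.absCont a (hJ ha) b (hJ hb),
    ae_restrict_of_ae_restrict_of_subset hJ hz.deriv_mem⟩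

lemma absCont_fst (hz : IsFilippovSolution F I z) (ha : a ∈ I) (hb : b ∈ I) (hab : a ≤ b) :
    AbsolutelyContinuousOnInterval (fun t => (z t).1) a b :=
  (hz.absCont a ha b hb hab).lipschitzWith_one_comp LipschitzWith.prod_fst

lemma absCont_snd (hz : IsFilippovSolution F I z) (ha : a ∈ I) (hb : b ∈ I) (hab : a ≤ b) :
    AbsolutelyContinuousOnInterval (fun t => (z t).2) a b :=
  (hz.absCont a ha b hb hab).lipschitzWith_one_comp LipschitzWith.prod_snd

lemma continuousOn (hz : IsFilippovSolution F I z) (ha : a ∈ I) (hb : b ∈ I) (hab : a ≤ b) :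
    ContinuousOn z (Icc a b) := by
  simpa [uIcc_of_le hab] using (hz.absCont a ha b hb hab).continuousOn

lemma ae_hasDerivAt (hz : IsFilippovSolution F I z) (hI : I.OrdConnected) (ha : a ∈ I)
    (hb : b ∈ I) : ∀ᵐ t, t ∈ Ioo a b → ∃ v ∈ filippovMap F (z t),
      HasDerivAt (fun s => (z s).1) v.1 t ∧ HasDerivAt (fun s => (z s).2) v.2 t := by
  have := (hz.mono (Ioo_subset_Icc_self.trans (hI.out ha hb))).deriv_mem
  rw [ae_restrict_iff' measurableSet_Ioo] at this
  filter_upwards [this] with t ht hmem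
  obtain ⟨v, hv, hd⟩ := ht hmem
  exact ⟨v, hv, (hasFDerivAt_fst (p := z t)).comp_hasDerivAt t hd,
    (hasFDerivAt_snd (p := z t)).comp_hasDerivAt t hd⟩

/-- After a last time with `η ≥ 0`, `η` would be negative yet nondecreasing. -/
lemma snd_nonneg {g h : ℝ → ℝ → ℝ} (hz : IsFilippovSolution (extendedField g h) I z)
    (hI : I.OrdConnected) (ha : a ∈ I) (hb : b ∈ I) (hab : a ≤ b) (h0 : 0 ≤ (z a).2) :
    0 ≤ (z b).2 := by
  by_contra hneg
  obtain ⟨s, hs, hs0, hlt⟩ := (continuous_snd.comp_continuousOn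
    (hz.continuousOn ha hb hab)).exists_last_nonneg hab h0 (not_le.1 hneg)
  have hsI : s ∈ I := hI.out ha hb ⟨hs.1, hs.2.le⟩
  have := (hz.absCont_snd hsI hb hs.2.le).le_of_ae_hasDerivAt_nonneg hs.2.le (by
    filter_upwards [hz.ae_hasDerivAt hI hsI hb] with t ht hmem
    obtain ⟨v, hv, -, hd⟩ := ht hmem
    exact ⟨v.2, hd, snd_nonneg_of_mem_filippovMap (hlt t ⟨hmem.1, hmem.2.le⟩) hv⟩)
  exact hneg (hs0.trans this)

/-- A solution that stays in `η ≥ 0` before `b` cannot reach the boundary at time `b` where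
`h > 0`. -/
lemma nonpos_of_snd_eq_zero {g h : ℝ → ℝ → ℝ} (hg : Continuous fun w : ℝ × ℝ => g w.1 w.2)
    (hh : Continuous fun w : ℝ × ℝ => h w.1 w.2)
    (hz : IsFilippovSolution (extendedField g h) I z)
    (hI : I.OrdConnected) (ha : a ∈ I) (hb : b ∈ I) (hab : a < b) (h0 : 0 ≤ (z a).2)
    (hb0 : (z b).2 = 0) : h (z b).1 0 ≤ 0 := by
  by_contra hpos
  replace hpos : 0 < h (z b).1 (z b).2 := by rw [hb0]; exact not_le.1 hpos
  have hev : ∀ᶠ w in 𝓝 (z b), w.2 < 1 ∧ 0 < h w.1 w.2 :=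
    (continuous_snd.continuousAt.eventually_lt_const (by simp [hb0])).and
      (hh.continuousAt.eventually_const_lt hpos)
  have hcont := hz.continuousOn ha hb hab.le b (right_mem_Icc.2 hab.le)
  have hev' := hcont.eventually hev
  rw [nhdsWithin_Icc_eq_nhdsLE hab] at hev'
  obtain ⟨l, hl, hlsub⟩ := (mem_nhdsLE_iff_exists_Ioc_subset' hab).1 hev'
  have hl : l < b := hl
  -- On `(c, b]` both `η < 1` and `h > 0` hold, so `η` increases to `0` and `η(c) < 0`; `c ≥ a`
  -- makes this contradict invariance.
  set c := max a ((l + b) / 2) with hc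
  have hac : a ≤ c := le_max_left _ _
  have hcb : c < b := max_lt hab (by linarith)
  have hlc : l < c := lt_of_lt_of_le (by linarith) (le_max_right _ _)
  have hcI : c ∈ I := hI.out ha hb ⟨hac, hcb.le⟩
  have := (hz.absCont_snd hcI hb hcb.le).lt_of_ae_hasDerivAt_pos hcb (by
    filter_upwards [hz.ae_hasDerivAt hI hcI hb] with t ht hmem
    obtain ⟨v, hv, -, hd⟩ := ht hmem
    obtain ⟨h1, h2⟩ := hlsub ⟨hlc.trans hmem.1, hmem.2.le⟩
    refine ⟨v.2, hd, ?_⟩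
    rw [eq_of_mem_filippovMap_of_pos hg hh h1 h2 hv]
    exact h2)
  rw [hb0] at this
  exact absurd (hz.snd_nonneg hI ha hcI hac h0) (not_le.2 this)

end IsFilippovSolution

/-! ### Sliding and leaving estimates -/

section Ice

variable {δ ηc ρ B c₀ c₁ c₂ c₃ : ℝ}

lemma continuous_greenhouseRate : Continuous fun w : ℝ × ℝ => greenhouseRate δ ηc w.1 w.2 := by
  unfold greenhouseRate
  fun_prop

lemma contDiff_iceLineRate :
    ContDiff ℝ 1 fun w : ℝ × ℝ => iceLineRate ρ B c₀ c₁ c₂ c₃ w.1 w.2 := by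
  unfold iceLineRate
  fun_prop

lemma continuous_iceLineRate :
    Continuous fun w : ℝ × ℝ => iceLineRate ρ B c₀ c₁ c₂ c₃ w.1 w.2 :=
  contDiff_iceLineRate.continuous

/-- The difference has the factor `η` and does not involve `A`, which gives a Gronwall constant
uniform in `A`. -/
lemma abs_iceLineRate_sub_le (hρ : 0 < ρ) {A η : ℝ} (h0 : 0 ≤ η) (h1 : η ≤ 1) :
    |iceLineRate ρ B c₀ c₁ c₂ c₃ A η - iceLineRate ρ B c₀ c₁ c₂ c₃ A 0| ≤
      ρ * (|c₁| + |c₂| + |c₃|) * η := by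
  have h : iceLineRate ρ B c₀ c₁ c₂ c₃ A η - iceLineRate ρ B c₀ c₁ c₂ c₃ A 0 =
      ρ * (c₁ + c₂ * η + c₃ * η ^ 2) * η := by
    unfold iceLineRate
    ring
  rw [h, abs_mul, abs_mul, abs_of_pos hρ, abs_of_nonneg h0]
  have h2 : |c₂ * η| ≤ |c₂| := by
    rw [abs_mul, abs_of_nonneg h0]
    exact mul_le_of_le_one_right (abs_nonneg _) h1
  have h3 : |c₃ * η ^ 2| ≤ |c₃| := by
    rw [abs_mul, abs_of_nonneg (sq_nonneg η)]
    exact mul_le_of_le_one_right (abs_nonneg _) (pow_le_one₀ h0 h1)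
  gcongr
  exact (abs_add_three _ _ _).trans (by linarith)

lemma iceLineRate_strictAnti (hρ : 0 < ρ) (hB : 0 < B) (η : ℝ) :
    StrictAnti fun A => iceLineRate ρ B c₀ c₁ c₂ c₃ A η := by
  intro A A' hA
  have : A / B < A' / B := div_lt_div_of_pos_right hA hB
  exact mul_lt_mul_of_pos_left (by linarith) hρ

variable {I : Set ℝ} {z : ℝ → ℝ × ℝ} {a b : ℝ}

lemma fst_ge_of_snd_nonneg (hδ : 0 < δ)
    (hz : IsFilippovSolution (iceField δ ηc ρ B c₀ c₁ c₂ c₃) I z) (hI : I.OrdConnected)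
    (ha : a ∈ I) (hb : b ∈ I) (hab : a ≤ b) (h0 : 0 ≤ (z a).2) :
    (z a).1 - δ * ηc * (b - a) ≤ (z b).1 := by
  have := ((hz.absCont_fst ha hb hab).add
    (absolutelyContinuousOnInterval_const_mul_id (δ * ηc) a b)).le_of_ae_hasDerivAt_nonneg hab (by
      filter_upwards [hz.ae_hasDerivAt hI ha hb] with t ht hmem
      obtain ⟨v, hv, hd, -⟩ := ht hmem
      refine ⟨_, hd.add ((hasDerivAt_id t).const_mul (δ * ηc)), ?_⟩
      rw [fst_eq_of_mem_filippovMap continuous_greenhouseRate hv, greenhouseRate]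
      have := hz.snd_nonneg hI ha (hI.out ha hb ⟨hmem.1.le, hmem.2.le⟩) hmem.1.le h0
      nlinarith [mul_nonneg hδ.le this])
  simp only [Pi.add_apply] at this
  linarith

lemma snd_eq_zero_of_sliding (hδ : 0 < δ) (hρ : 0 < ρ) (hB : 0 < B) (hηc : 0 < ηc)
    (hz : IsFilippovSolution (iceField δ ηc ρ B c₀ c₁ c₂ c₃) I z) (hI : I.OrdConnected)
    (ha : a ∈ I) (hb : b ∈ I) (hab : a ≤ b) (h0 : (z a).2 = 0)
    (hneg : iceLineRate ρ B c₀ c₁ c₂ c₃ ((z a).1 - δ * ηc * (b - a)) 0 ≤ 0) :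
    (z b).2 = 0 := by
  refine le_antisymm ?_ (hz.snd_nonneg hI ha hb hab h0.ge)
  by_contra hpos
  obtain ⟨s, hs, hs0, hlt⟩ := (continuous_snd.comp_continuousOn
    (hz.continuousOn ha hb hab)).neg.exists_last_nonneg hab (by simp [h0]) (by simpa using hpos)
  simp only [Function.comp_apply, Pi.neg_apply, neg_nonneg, neg_lt_zero] at hs0 hlt
  have hsI : s ∈ I := hI.out ha hb ⟨hs.1, hs.2.le⟩
  have hcont := (hz.continuousOn hsI hb hs.2.le) s (left_mem_Icc.2 hs.2.le)
  have hev := hcont.eventually (continuous_snd.continuousAt.eventually_lt_const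
    (show (z s).2 < 1 by linarith))
  rw [nhdsWithin_Icc_eq_nhdsGE hs.2] at hev
  obtain ⟨u, hu, husub⟩ := (mem_nhdsGE_iff_exists_Ico_subset' hs.2).1 hev
  have hu : s < u := hu
  -- After the last time `s` with `η ≤ 0`, the orbit has `0 < η < 1` on `(s, c)`, where the velocity
  -- is the physical one.
  set c := min b ((s + u) / 2) with hc
  have hsc : s < c := lt_min hs.2 (by linarith)
  have hcb : c ≤ b := min_le_left _ _
  have hcu : c < u := lt_of_le_of_lt (min_le_right _ _) (by linarith)
  have hcI : c ∈ I := hI.out hsI hb ⟨hsc.le, hcb⟩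
  set L := ρ * (|c₁| + |c₂| + |c₃|) with hL
  -- Gronwall: `exp (-L t) η` cannot increase, yet it is `≤ 0` at `s` and positive at `c`.
  have hmono := ((absolutelyContinuousOnInterval_exp_mul (-L) s c).mul
    (hz.absCont_snd hsI hcI hsc.le)).neg.le_of_ae_hasDerivAt_nonneg hsc.le (by
      filter_upwards [hz.ae_hasDerivAt hI hsI hcI] with t ht hmem
      obtain ⟨v, hv, -, hd⟩ := ht hmem
      have ht0 : 0 < (z t).2 := hlt t ⟨hmem.1, hmem.2.le.trans hcb⟩
      have ht1 : (z t).2 < 1 := husub ⟨hmem.1.le, hmem.2.trans hcu⟩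
      have htI : t ∈ I := hI.out hsI hcI ⟨hmem.1.le, hmem.2.le⟩
      refine ⟨_, (hd.exp_mul_mul (-L)).neg, ?_⟩
      rw [eq_of_mem_filippovMap_of_mem_Ioo continuous_greenhouseRate continuous_iceLineRate
        ht0 ht1 hv, neg_nonneg]
      refine mul_nonpos_of_nonneg_of_nonpos (Real.exp_pos _).le ?_
      have hA := fst_ge_of_snd_nonneg hδ hz hI ha htI (hs.1.trans hmem.1.le) h0.ge
      have htb : δ * ηc * (t - a) ≤ δ * ηc * (b - a) := by
        gcongr
        exact hmem.2.le.trans hcb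
      have h1 := (iceLineRate_strictAnti (c₀ := c₀) (c₁ := c₁) (c₂ := c₂) (c₃ := c₃)
        hρ hB 0).antitone (show (z a).1 - δ * ηc * (b - a) ≤ (z t).1 by linarith)
      have h2 := (abs_le.1 (abs_iceLineRate_sub_le (B := B) (c₀ := c₀) (c₁ := c₁) (c₂ := c₂)
        (c₃ := c₃) (A := (z t).1) hρ ht0.le ht1.le)).2
      simp only at h1 ⊢
      linarith)
  simp only [Pi.neg_apply, Pi.mul_apply] at hmono
  have h1 := mul_pos (Real.exp_pos (-L * c)) (hlt c ⟨hsc, hcb⟩)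
  have h2 := mul_nonpos_of_nonneg_of_nonpos (Real.exp_pos (-L * s)).le hs0
  linarith

lemma fst_eq_of_sliding
    (hz : IsFilippovSolution (iceField δ ηc ρ B c₀ c₁ c₂ c₃) I z) (hI : I.OrdConnected)
    (ha : a ∈ I) (hb : b ∈ I) (hab : a ≤ b) (h0 : ∀ t ∈ Icc a b, (z t).2 = 0) :
    (z b).1 = (z a).1 - δ * ηc * (b - a) := by
  have hac := (hz.absCont_fst ha hb hab).add
    (absolutelyContinuousOnInterval_const_mul_id (δ * ηc) a b)
  have hd : ∀ᵐ t, t ∈ Ioo a b →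
      HasDerivAt ((fun t => (z t).1) + fun t => δ * ηc * t) 0 t := by
    filter_upwards [hz.ae_hasDerivAt hI ha hb] with t ht hmem
    obtain ⟨v, hv, hd, -⟩ := ht hmem
    refine (hd.add ((hasDerivAt_id t).const_mul (δ * ηc))).congr_deriv ?_
    rw [fst_eq_of_mem_filippovMap continuous_greenhouseRate hv, greenhouseRate,
      h0 t ⟨hmem.1.le, hmem.2.le⟩]
    ring
  have h1 := hac.le_of_ae_hasDerivAt_nonneg hab (by
    filter_upwards [hd] with t ht hmem using ⟨0, ht hmem, le_rfl⟩)
  have h2 := hac.neg.le_of_ae_hasDerivAt_nonneg hab (by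
    filter_upwards [hd] with t ht hmem using ⟨_, (ht hmem).neg, by simp⟩)
  simp only [Pi.add_apply, Pi.neg_apply] at h1 h2
  linarith

lemma exists_leaving (hδ : 0 < δ) (hρ : 0 < ρ) (hB : 0 < B) (hηc : 0 < ηc)
    (hz : IsFilippovSolution (iceField δ ηc ρ B c₀ c₁ c₂ c₃) I z) (hI : I.OrdConnected)
    (ha : a ∈ I) (hb : b ∈ I) (hab : a < b) (h0 : (z a).2 = 0)
    (hnn : 0 ≤ iceLineRate ρ B c₀ c₁ c₂ c₃ (z a).1 0) :
    ∃ ε > 0, ∀ t ∈ Ioc a (a + ε), t ∈ I ∧ 0 < (z t).2 ∧ (z t).2 < 1 := by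
  have hcont := (hz.continuousOn ha hb hab.le) a (left_mem_Icc.2 hab.le)
  -- `η < ηc` makes `A` strictly decrease, which gives `h(A, 0) > 0` even when it starts at `0`.
  have hev := hcont.eventually (continuous_snd.continuousAt.eventually_lt_const
    (show (z a).2 < min 1 ηc by rw [h0]; exact lt_min one_pos hηc))
  rw [nhdsWithin_Icc_eq_nhdsGE hab] at hev
  obtain ⟨u, hu, husub⟩ := (mem_nhdsGE_iff_exists_Ico_subset' hab).1 hev
  have hu : a < u := hu
  set c := min b ((a + u) / 2) with hc
  have hac : a < c := lt_min hab (by linarith)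
  have hcb : c ≤ b := min_le_left _ _
  have hcu : c < u := lt_of_le_of_lt (min_le_right _ _) (by linarith)
  have hsmall : ∀ t ∈ Icc a c, (z t).2 < 1 ∧ (z t).2 < ηc := fun t ht =>
    lt_min_iff.1 (husub ⟨ht.1, ht.2.trans_lt hcu⟩)
  refine ⟨c - a, sub_pos.2 hac, fun t ht => ?_⟩
  rw [add_sub_cancel] at ht
  have htI : t ∈ I := hI.out ha hb ⟨ht.1.le, ht.2.trans hcb⟩
  refine ⟨htI, ?_, (hsmall t ⟨ht.1.le, ht.2⟩).1⟩
  have hA : ∀ s ∈ Ioc a c, (z s).1 < (z a).1 := fun s hs => by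
    have hsI : s ∈ I := hI.out ha hb ⟨hs.1.le, hs.2.trans hcb⟩
    have := (hz.absCont_fst ha hsI hs.1.le).neg.lt_of_ae_hasDerivAt_pos hs.1 (by
      filter_upwards [hz.ae_hasDerivAt hI ha hsI] with r hr hmem
      obtain ⟨v, hv, hd, -⟩ := hr hmem
      refine ⟨_, hd.neg, ?_⟩
      rw [fst_eq_of_mem_filippovMap continuous_greenhouseRate hv, greenhouseRate]
      nlinarith [(hsmall r ⟨hmem.1.le, hmem.2.le.trans hs.2⟩).2])
    simpa using this
  set L := ρ * (|c₁| + |c₂| + |c₃|) with hL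
  have hmono := ((absolutelyContinuousOnInterval_exp_mul L a t).mul
    (hz.absCont_snd ha htI ht.1.le)).lt_of_ae_hasDerivAt_pos ht.1 (by
      filter_upwards [hz.ae_hasDerivAt hI ha htI] with s hs hmem
      obtain ⟨v, hv, -, hd⟩ := hs hmem
      have hsc : s ∈ Ioc a c := ⟨hmem.1, hmem.2.le.trans ht.2⟩
      have hs1 := (hsmall s (Ioc_subset_Icc_self hsc)).1
      have hs0 := hz.snd_nonneg hI ha (hI.out ha htI ⟨hmem.1.le, hmem.2.le⟩) hmem.1.le h0.ge
      have h1 : 0 < iceLineRate ρ B c₀ c₁ c₂ c₃ (z s).1 0 :=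
        hnn.trans_lt (iceLineRate_strictAnti hρ hB 0 (hA s hsc))
      have hveq : v.2 = iceLineRate ρ B c₀ c₁ c₂ c₃ (z s).1 (z s).2 := by
        rcases hs0.eq_or_lt with h | h
        · rw [eq_of_mem_filippovMap_of_pos continuous_greenhouseRate continuous_iceLineRate
            hs1 (by rwa [← h]) hv]
        · rw [eq_of_mem_filippovMap_of_mem_Ioo continuous_greenhouseRate continuous_iceLineRate
            h hs1 hv]
      refine ⟨_, hd.exp_mul_mul L, mul_pos (Real.exp_pos _) ?_⟩
      have h2 := (abs_le.1 (abs_iceLineRate_sub_le (B := B) (c₀ := c₀) (c₁ := c₁) (c₂ := c₂)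
        (c₃ := c₃) (A := (z s).1) hρ hs0 hs1.le)).1
      linarith)
  simp only [Pi.mul_apply, h0, mul_zero] at hmono
  exact pos_of_mul_pos_right hmono (Real.exp_pos _).le

end Ice

/-- A solution on `[t₁, t₂]` that agrees with the orbit where both are defined and reaches beyond the
orbit's interval of definition would continue it, so that interval already contains `t₂`. -/
lemma IsForwardOrbit.mem_of_extension {F : ℝ × ℝ → ℝ × ℝ} {I : Set ℝ} {z w : ℝ → ℝ × ℝ}
    (hz : IsForwardOrbit F I z) {t₁ t₂ : ℝ} (ht₁ : t₁ ∈ I) (h12 : t₁ ≤ t₂)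
    (hw : AbsolutelyContinuousOnInterval w t₁ t₂)
    (hd : ∀ t ∈ Ioo t₁ t₂, ∃ v ∈ filippovMap F (w t), HasDerivAt w v t)
    (heq : EqOn w z (I ∩ Icc t₁ t₂)) (hI : I ⊆ Iic t₂) : t₂ ∈ I := by
  have h0 : 0 ≤ t₁ := hz.interval.2.1 ht₁
  have hw1 : w t₁ = z t₁ := heq ⟨ht₁, le_rfl, h12⟩
  set u : ℝ → ℝ × ℝ := fun t => if t ≤ t₁ then z t else w t with hu
  have hJ : Icc 0 t₂ = I := by
    refine hz.maximal (Icc 0 t₂) u ⟨left_mem_Icc.2 (h0.trans h12), fun t ht => ht.1,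
      ordConnected_Icc⟩ (fun t ht => ⟨hz.interval.2.1 ht, hI ht⟩) ⟨?_, ?_⟩ ?_
    -- Clamping time at `t₁` writes the glued curve as one sum of absolutely continuous terms; `- w
    -- t₁` removes the frozen value.
    · have hsum : u = fun t => (z (min t t₁) + w (max t t₁)) - w t₁ := by
        funext t
        by_cases h : t ≤ t₁
        · simp [hu, h]
        · simp [hu, h, (not_le.1 h).le, hw1]
      have hmin : LipschitzWith 1 fun t : ℝ => min t t₁ := LipschitzWith.id.min_const t₁
      have hmax : LipschitzWith 1 fun t : ℝ => max t t₁ := LipschitzWith.id.max_const t₁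
      have hac : AbsolutelyContinuousOnInterval u 0 t₂ := by
        rw [hsum]
        refine ((AbsolutelyContinuousOnInterval.comp_monotone_lipschitzWith_one
          (hz.solution.absCont 0 hz.interval.1 t₁ ht₁ h0)
          (fun s t hst => min_le_min_right _ hst) hmin ?_).add
          (hw.comp_monotone_lipschitzWith_one (fun s t hst => max_le_max_right _ hst) hmax ?_)).sub
          (ContDiffOn.absolutelyContinuousOnInterval contDiffOn_const)
        · rw [uIcc_of_le (h0.trans h12), uIcc_of_le h0]
          exact fun t ht => ⟨le_min ht.1 h0, min_le_right _ _⟩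
        · rw [uIcc_of_le (h0.trans h12), uIcc_of_le h12]
          exact fun t ht => ⟨le_max_right _ _, max_le ht.2 h12⟩
      intro a ha b hb hab
      refine hac.mono ?_
      rw [uIcc_of_le hab, uIcc_of_le (h0.trans h12)]
      exact Icc_subset_Icc ha.1 hb.2
    · have hsol := (hz.solution.mono (hz.interval.2.2.out hz.interval.1 ht₁)).deriv_mem
      rw [ae_restrict_iff' measurableSet_Icc] at hsol ⊢
      have h1 : ∀ᵐ t : ℝ, t ≠ t₁ := by simp [ae_iff]
      have h2 : ∀ᵐ t : ℝ, t ≠ t₂ := by simp [ae_iff]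
      filter_upwards [hsol, h1, h2] with t ht ht1 ht2 hmem
      rcases lt_or_gt_of_ne ht1 with hlt | hlt
      · obtain ⟨v, hv, hdv⟩ := ht ⟨hmem.1, hlt.le⟩
        refine ⟨v, by simpa [hu, hlt.le] using hv, hdv.congr_of_eventuallyEq ?_⟩
        filter_upwards [Iio_mem_nhds hlt] with s hs
        simp [hu, (mem_Iio.1 hs).le]
      · obtain ⟨v, hv, hdv⟩ := hd t ⟨hlt, lt_of_le_of_ne hmem.2 ht2⟩
        refine ⟨v, by simpa [hu, not_le.2 hlt] using hv, hdv.congr_of_eventuallyEq ?_⟩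
        filter_upwards [Ioi_mem_nhds hlt] with s hs
        simp [hu, not_le.2 (mem_Ioi.1 hs)]
    · intro t ht
      by_cases h : t ≤ t₁
      · simp [hu, h]
      · simpa [hu, h] using heq ⟨ht, (not_le.1 h).le, hI ht⟩
  exact hJ ▸ right_mem_Icc.2 (h0.trans h12)

/-! ### Local existence of a leaving solution -/

variable {δ ηc ρ B c₀ c₁ c₂ c₃ : ℝ}

lemma hasDerivAt_iceLineRate {α : ℝ → ℝ × ℝ} {v : ℝ × ℝ} {t : ℝ} (hα : HasDerivAt α v t) :
    HasDerivAt (fun s => iceLineRate ρ B c₀ c₁ c₂ c₃ (α s).1 (α s).2)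
      (ρ * ((c₁ + 2 * c₂ * (α t).2 + 3 * c₃ * (α t).2 ^ 2) * v.2 - v.1 / B)) t := by
  have h1 : HasDerivAt (fun s => (α s).1) v.1 t :=
    (hasFDerivAt_fst (p := α t)).comp_hasDerivAt t hα
  have h2 : HasDerivAt (fun s => (α s).2) v.2 t :=
    (hasFDerivAt_snd (p := α t)).comp_hasDerivAt t hα
  have := ((((h2.const_mul c₁).const_add c₀).add ((h2.pow 2).const_mul c₂)).add
    ((h2.pow 3).const_mul c₃)).sub (h1.div_const B) |>.const_mul ρ
  refine this.congr_deriv ?_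
  push_cast
  ring

/-- The smooth physical field has a solution through `z₀`; it is a Filippov solution because it
enters the open strip at once. -/
lemma exists_leaving_solution (hδ : 0 < δ) (hρ : 0 < ρ) (hB : 0 < B) (hηc : 0 < ηc)
    {z₀ : ℝ × ℝ} (h0 : z₀.2 = 0) (hnn : 0 ≤ iceLineRate ρ B c₀ c₁ c₂ c₃ z₀.1 0) (t₁ : ℝ) :
    ∃ t₂ > t₁, ∃ w : ℝ → ℝ × ℝ, w t₁ = z₀ ∧ AbsolutelyContinuousOnInterval w t₁ t₂ ∧
      ∀ t ∈ Ioo t₁ t₂, ∃ v ∈ filippovMap (iceField δ ηc ρ B c₀ c₁ c₂ c₃) (w t),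
        HasDerivAt w v t := by
  set G : ℝ × ℝ → ℝ × ℝ := fun w =>
    (greenhouseRate δ ηc w.1 w.2, iceLineRate ρ B c₀ c₁ c₂ c₃ w.1 w.2) with hG
  have hGc : ContDiff ℝ 1 G := by
    refine ContDiff.prodMk ?_ contDiff_iceLineRate
    unfold greenhouseRate
    fun_prop
  obtain ⟨w, hw1, ε, hε, hw⟩ :=
    hGc.contDiffAt.exists_forall_mem_closedBall_exists_eq_forall_mem_Ioo_hasDerivAt₀
      (x₀ := z₀) t₁
  have hw' := hw t₁ ⟨by linarith, by linarith⟩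
  have hrate : ∀ᶠ t in 𝓝[>] t₁, 0 < iceLineRate ρ B c₀ c₁ c₂ c₃ (w t).1 (w t).2 := by
    have hH := hasDerivAt_iceLineRate (ρ := ρ) (B := B) (c₀ := c₀) (c₁ := c₁) (c₂ := c₂)
      (c₃ := c₃) hw'
    have hval : iceLineRate ρ B c₀ c₁ c₂ c₃ (w t₁).1 (w t₁).2 =
        iceLineRate ρ B c₀ c₁ c₂ c₃ z₀.1 0 := by rw [hw1, h0]
    rcases hnn.eq_or_lt with hzero | hpos
    -- At the tangency `η' = h = 0`, so only the `A` term remains and `h` grows at rate `ρ δ ηc /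
    -- B`.
    · have hder : 0 < deriv (fun s => iceLineRate ρ B c₀ c₁ c₂ c₃ (w s).1 (w s).2) t₁ := by
        rw [hH.deriv]
        simp only [hG, ← hzero, hw1, h0, greenhouseRate]
        have : 0 < δ * ηc / B := by positivity
        refine mul_pos hρ ?_
        have h3 : δ * (0 - ηc) / B = -(δ * ηc / B) := by ring
        rw [h3]
        linarith
      have hsign := eventually_nhdsWithin_sign_eq_of_deriv_pos hder (hval.trans hzero.symm)
      filter_upwards [nhdsWithin_le_nhds hsign, self_mem_nhdsWithin] with t ht htpos
      rwa [sign_pos (sub_pos.2 htpos), sign_eq_one_iff] at ht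
    · exact nhdsWithin_le_nhds (hH.continuousAt.eventually_const_lt (hpos.trans_eq hval.symm))
  have hlt : ∀ᶠ t in 𝓝[>] t₁, (w t).2 < 1 := nhdsWithin_le_nhds
    ((continuous_snd.continuousAt.comp hw'.continuousAt).eventually_lt_const (by simp [hw1, h0]))
  obtain ⟨u, hu, husub⟩ := mem_nhdsGT_iff_exists_Ioo_subset.1 (hrate.and hlt)
  have hu : t₁ < u := hu
  set t₂ := min u (t₁ + ε / 2) with ht₂
  have h12 : t₁ < t₂ := lt_min hu (by linarith)
  have ht₂ε : t₂ < t₁ + ε := lt_of_le_of_lt (min_le_right _ _) (by linarith)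
  have hderiv : ∀ t ∈ Icc t₁ t₂, HasDerivAt w (G (w t)) t := fun t ht =>
    hw t ⟨by linarith [ht.1], by linarith [ht.2]⟩
  have hcont : ContinuousOn w (Icc t₁ t₂) := fun t ht =>
    (hderiv t ht).continuousAt.continuousWithinAt
  have hac : AbsolutelyContinuousOnInterval w t₁ t₂ := by
    obtain ⟨C, hC⟩ := isCompact_Icc.exists_bound_of_continuousOn
      (hGc.continuous.comp_continuousOn hcont)
    refine LipschitzOnWith.absolutelyContinuousOnInterval (K := C.toNNReal) ?_
    rw [uIcc_of_le h12.le]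
    refine (convex_Icc t₁ t₂).lipschitzOnWith_of_nnnorm_hasDerivWithin_le
      (fun t ht => (hderiv t ht).hasDerivWithinAt) fun t ht => ?_
    rw [← NNReal.coe_le_coe, coe_nnnorm]
    exact (hC t ht).trans (Real.le_coe_toNNReal C)
  refine ⟨t₂, h12, w, hw1, hac, fun t ht => ⟨G (w t), ?_, hderiv t (Ioo_subset_Icc_self ht)⟩⟩
  have hsub : Ioo t₁ t ⊆ Ioo t₁ u := Ioo_subset_Ioo_right (ht.2.le.trans (min_le_left _ _))
  have hpos : (w t₁).2 < (w t).2 := by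
    have hac' : AbsolutelyContinuousOnInterval (fun s => (w s).2) t₁ t := by
      refine (hac.mono ?_).lipschitzWith_one_comp LipschitzWith.prod_snd
      rw [uIcc_of_le ht.1.le, uIcc_of_le h12.le]
      exact Icc_subset_Icc_right ht.2.le
    refine hac'.lt_of_ae_hasDerivAt_pos ht.1 (Eventually.of_forall fun s hs => ?_)
    exact ⟨_, (hasFDerivAt_snd (p := w s)).comp_hasDerivAt s
      (hderiv s ⟨hs.1.le, hs.2.le.trans ht.2.le⟩), (husub (hsub hs)).1⟩
  rw [hw1, h0] at hpos
  exact mem_filippovMap_of_mem_Ioo continuous_greenhouseRate continuous_iceLineRate hpos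
    (husub ⟨ht.1, ht.2.trans_le (min_le_left _ _)⟩).2

lemma iceLineRate_sub (hB : B ≠ 0) (A x η : ℝ) : iceLineRate ρ B c₀ c₁ c₂ c₃ (A - x) η =
    iceLineRate ρ B c₀ c₁ c₂ c₃ A η + ρ * x / B := by
  unfold iceLineRate
  field_simp
  ring

end IceLine

/-! ### Sliding, tangency and departure of a maximal orbit -/

theorem theorem2 (δ ηc ρ B c₀ c₁ c₂ c₃ : ℝ) (hδ : 0 < δ) (hρ : 0 < ρ) (hB : 0 < B) (hηc : 0 < ηc)
    (I : Set ℝ) (z : ℝ → ℝ × ℝ)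
    (hz : IceLine.IsForwardOrbit (IceLine.iceField δ ηc ρ B c₀ c₁ c₂ c₃) I z)
    (t₀ : ℝ) (ht₀ : t₀ ∈ I) (hentry : (z t₀).2 = 0) :
    -- an orbit that comes from the strip or from the boundary arrives where `h(A, 0) ≤ 0`
    ((∃ s ∈ I, s < t₀ ∧ 0 ≤ (z s).2) →
      IceLine.iceLineRate ρ B c₀ c₁ c₂ c₃ (z t₀).1 0 ≤ 0) ∧
    -- `τ` is the time at which the orbit leaves the boundary
    ∃ τ ∈ I, t₀ ≤ τ ∧
      (∀ t ∈ Set.Icc t₀ τ, (z t).1 = (z t₀).1 - δ * ηc * (t - t₀) ∧ (z t).2 = 0) ∧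
      (IceLine.iceLineRate ρ B c₀ c₁ c₂ c₃ (z t₀).1 0 ≤ 0 →
        IceLine.iceLineRate ρ B c₀ c₁ c₂ c₃ (z τ).1 0 = 0) ∧
      (0 < IceLine.iceLineRate ρ B c₀ c₁ c₂ c₃ (z t₀).1 0 → τ = t₀) ∧
      ∃ ε > 0, ∀ t ∈ Set.Ioc τ (τ + ε), t ∈ I ∧ 0 < (z t).2 ∧ (z t).2 < 1 := by
  have hI := hz.interval.2.2
  have hsol := hz.solution
  refine ⟨fun ⟨s, hs, hst, hs0⟩ => hsol.nonpos_of_snd_eq_zero IceLine.continuous_greenhouseRate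
    IceLine.continuous_iceLineRate hI hs ht₀ hst hs0 hentry, ?_⟩
  have hleave : ∀ τ ∈ I, (z τ).2 = 0 → 0 ≤ IceLine.iceLineRate ρ B c₀ c₁ c₂ c₃ (z τ).1 0 →
      ∃ ε > 0, ∀ t ∈ Set.Ioc τ (τ + ε), t ∈ I ∧ 0 < (z t).2 ∧ (z t).2 < 1 := by
    intro τ hτ hτ0 hnn
    obtain ⟨b, hb, hτb⟩ : ∃ b ∈ I, τ < b := by
      by_contra! hmax
      obtain ⟨t₂, ht₂, w, hw, hac, hd⟩ :=
        IceLine.exists_leaving_solution hδ hρ hB hηc hτ0 hnn τ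
      refine absurd (hmax t₂ (hz.mem_of_extension hτ ht₂.le hac hd ?_ ?_)) (not_le.2 ht₂)
      · rintro t ⟨htI, ht, -⟩
        rw [le_antisymm (hmax t htI) ht, hw]
      · exact fun t ht => (hmax t ht).trans ht₂.le
    exact IceLine.exists_leaving hδ hρ hB hηc hsol hI hτ hb hτb hτ0 hnn
  rcases le_or_gt (IceLine.iceLineRate ρ B c₀ c₁ c₂ c₃ (z t₀).1 0) 0 with hle | hpos
  swap
  · refine ⟨t₀, ht₀, le_rfl, fun t ht => ?_, fun h => absurd h (not_le.2 hpos), fun _ => rfl,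
      hleave t₀ ht₀ hentry hpos.le⟩
    obtain rfl : t = t₀ := le_antisymm ht.2 ht.1
    simp [hentry]
  set h₀ := IceLine.iceLineRate ρ B c₀ c₁ c₂ c₃ (z t₀).1 0 with hh₀
  -- While sliding, `h(A, 0)` grows linearly from `h₀` at rate `ρ δ ηc / B`; this is its zero.
  set τ := t₀ + -h₀ * B / (ρ * δ * ηc) with hτdef
  have hτ₀ : t₀ ≤ τ := by
    have : 0 ≤ -h₀ * B / (ρ * δ * ηc) :=
      div_nonneg (mul_nonneg (neg_nonneg.2 hle) hB.le) (by positivity)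
    linarith
  have hrate : IceLine.iceLineRate ρ B c₀ c₁ c₂ c₃ ((z t₀).1 - δ * ηc * (τ - t₀)) 0 = 0 := by
    rw [IceLine.iceLineRate_sub hB.ne', ← hh₀, hτdef]
    field_simp
    ring
  have hrate' : ∀ t ≤ τ,
      IceLine.iceLineRate ρ B c₀ c₁ c₂ c₃ ((z t₀).1 - δ * ηc * (t - t₀)) 0 ≤ 0 := by
    intro t ht
    refine le_of_le_of_eq ((IceLine.iceLineRate_strictAnti hρ hB 0).antitone ?_) hrate
    have : δ * ηc * (t - t₀) ≤ δ * ηc * (τ - t₀) := by gcongr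
    linarith
  have hslide : ∀ t ∈ I, t ∈ Icc t₀ τ →
      (z t).1 = (z t₀).1 - δ * ηc * (t - t₀) ∧ (z t).2 = 0 := by
    have h2 : ∀ t ∈ I, t ∈ Icc t₀ τ → (z t).2 = 0 := fun t ht htm =>
      IceLine.snd_eq_zero_of_sliding hδ hρ hB hηc hsol hI ht₀ ht htm.1 hentry (hrate' t htm.2)
    exact fun t ht htm => ⟨IceLine.fst_eq_of_sliding hsol hI ht₀ ht htm.1 fun s hs =>
      h2 s (hI.out ht₀ ht hs) ⟨hs.1, hs.2.trans htm.2⟩, h2 t ht htm⟩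
  have hτI : τ ∈ I := by
    by_contra hτI
    -- If the orbit ended before `τ`, the explicit sliding motion, with which it agrees so far,
    -- would continue it.
    refine hτI (hz.mem_of_extension (w := fun t => ((z t₀).1 - δ * ηc * (t - t₀), 0)) ht₀ hτ₀
      (ContDiffOn.absolutelyContinuousOnInterval (ContDiff.contDiffOn (by fun_prop)))
      (fun t ht => ⟨(δ * (0 - ηc), 0), ?_, ?_⟩) ?_ ?_)
    · exact IceLine.mem_filippovMap_of_boundary IceLine.continuous_greenhouseRate
        IceLine.continuous_iceLineRate rfl (hrate' t ht.2.le)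
    · refine HasDerivAt.prodMk ?_ (hasDerivAt_const t 0)
      exact ((((hasDerivAt_id t).sub_const t₀).const_mul (δ * ηc)).const_sub _).congr_deriv
        (by ring)
    · rintro t ⟨ht, htm⟩
      obtain ⟨h1, h2⟩ := hslide t ht htm
      exact Prod.ext h1.symm h2.symm
    · intro t ht
      by_contra hlt
      exact hτI (hI.out ht₀ ht ⟨hτ₀, (not_le.1 hlt).le⟩)
  have hsτ := hslide τ hτI ⟨hτ₀, le_rfl⟩
  have hτrate : IceLine.iceLineRate ρ B c₀ c₁ c₂ c₃ (z τ).1 0 = 0 := by rw [hsτ.1, hrate]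
  exact ⟨τ, hτI, hτ₀, fun t ht => hslide t (hI.out ht₀ hτI ht) ht, fun _ => hτrate,
    fun h => absurd hle (not_le.2 h), hleave τ hτI hsτ.2 hτrate.ge⟩
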